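/- Let $(\Omega,\mu)$ be a $\sigma$-finite measure space and $\mathcal H$ a separable complex Hilbert space. Let $D\subseteq L^\infty(\Omega)$ be a determining set for $L^1(\Omega)$, that is, if $f\in L^1(\Omega)$ and $\int_\Omega f g\,d\mu=0$ for all $g\in D$, then $f=0$. For a finite family $\Phi_1,\dots,\Phi_n\in L^2(\Omega,\mathcal H)$ let $$M_D(\Phi_1,\dots,\Phi_n)=\overline{\operatorname{span}}\{g\Phi_i : g\in D,\ 1\le i\le n\}\subseteq L^2(\Omega,\mathcal H)$$ be the multiplicatively invariant (MI) space it generates. For a finitely generated MI space $M$ let $\ell(M)$, the length of $M$, be the least $n\in\{0,1,2,\dots\}$ for which there are $\Phi_1,\dots,\Phi_n\in M$ with $M=M_D(\Phi_1,\dots,\Phi_n)$. **Theorem.** Let $\Phi_1,\dots,\Phi_m\in L^2(\Omega,\mathcal H)$, let $M=M_D(\Phi_1,\dots,\Phi_m)$, and let $\ell$ be an integer with $\ell(M)\le\ell\le m$. For $A=(a_{ij})\in\mathbb C^{\ell\times m}$ put $\Psi_i=\sum_{j=1}^m a_{ij}\Phi_j$, $1\le i\le\ell$, and let $$\mathcal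 R=\{A\in\mathbb C^{\ell\times m} : M=M_D(\Psi_1,\dots,\Psi_\ell)\}.$$ Then $\mathbb C^{\ell\times m}\setminus\mathcal R$ has Lebesgue measure zero. -/

import Mathlib

open MeasureTheory
open scoped ENNReal

/-- A set `D ⊆ L^∞(Ω)` is a determining set for `L¹(Ω)` if the only `f ∈ L¹(Ω)` with
`∫ f g dμ = 0` for every `g ∈ D` is `f = 0`. (The products `f g` are integrable by Hölder.) -/
def IsDeterminingSet {Ω : Type*} [MeasurableSpace Ω] {μ : Measure Ω}
    (D : Set (Lp ℂ ∞ μ)) : Prop :=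
  ∀ f : Lp ℂ 1 μ, (∀ g ∈ D, ∫ ω, f ω * g ω ∂μ = 0) → f = 0

/-- `M_D(S)`, the closed linear span in `L²(Ω, H)` of the pointwise products `g Φ`,
`g ∈ D`, `Φ ∈ S`. The product `g • Φ` of an `L^∞` function and an `L²` function is Mathlib's
Hölder scalar multiplication, the class of `ω ↦ g ω • Φ ω`. -/
noncomputable def miSpan {Ω : Type*} [MeasurableSpace Ω] {μ : Measure Ω}
    {H : Type*} [NormedAddCommGroup H] [InnerProductSpace ℂ H]
    (D : Set (Lp ℂ ∞ μ)) (S : Set (Lp H 2 μ)) : Submodule ℂ (Lp H 2 μ) :=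
  (Submodule.span ℂ {F : Lp H 2 μ | ∃ g ∈ D, ∃ Φ ∈ S, F = g • Φ}).topologicalClosure

/-- The length `ℓ(M)` of a finitely generated space `M`: the least `n` such that `M` is generated
by some `Φ₁, …, Φₙ ∈ M`. (It is only used for `M` that is finitely generated, so the set below
is non-empty; the zero space has length `0`.) -/
noncomputable def miLength {Ω : Type*} [MeasurableSpace Ω] {μ : Measure Ω}
    {H : Type*} [NormedAddCommGroup H] [InnerProductSpace ℂ H]
    (D : Set (Lp ℂ ∞ μ)) (M : Submodule ℂ (Lp H 2 μ)) : ℕ :=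
  sInf {n : ℕ | ∃ Φ : Fin n → Lp H 2 μ, (∀ i, Φ i ∈ M) ∧ M = miSpan D (Set.range Φ)}

/-! Since `D` is determining, membership in a generated space is decided fibre by fibre
(`IsDeterminingSet.mem_miSpan_iff`). Hence almost every fibre span of the `Φ j ω` has dimension at
most `ℓ(M)`, and `A` is good once its combinations span that fibre for almost every `ω`. At a fixed
such `ω` the bad `A` lie in the zero set of a determinant that is not identically zero, so they form
a null set (`ae_forall_mem_span_sum_smul`). Fubini then exchanges "for a.e. `ω`, a.e. `A`" with "for
a.e. `A`, a.e. `ω`". -/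

section GenericCombinations

/-- On any real line in the direction of a basis, the determinant with respect to this basis vanishes
only on a null set. -/
theorem Module.Basis.ae_det_add_smul_self_ne_zero {V ι : Type*} [AddCommGroup V] [Module ℂ V]
    [Fintype ι] [DecidableEq ι] (b : Module.Basis ι ℂ V) (w : ι → V) :
    ∀ᵐ x : ℝ, b.det (w + (x : ℂ) • ⇑b) ≠ 0 := by
  have hfin : {x : ℝ | b.det (w + (x : ℂ) • ⇑b) = 0}.Finite := by
    -- With `W` the matrix of `w` in the basis `b`, `det (W + z I)` is the characteristic polynomial
    -- of `-W` at `z`; it is monic, so it has finitely many roots.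
    have hroots : {z : ℂ | (-(b.toMatrix w)).charpoly.eval z = 0}.Finite := by
      refine ((-(b.toMatrix w)).charpoly.roots.toFinset.finite_toSet).subset fun z hz => ?_
      simpa [(Matrix.charpoly_monic _).ne_zero, Polynomial.IsRoot] using hz
    refine (hroots.preimage (Complex.ofReal_injective.injOn)).subset fun x hx => ?_
    have hmat (z : ℂ) : Matrix.scalar ι z - -(b.toMatrix w) = b.toMatrix (w + z • ⇑b) := by
      ext i j
      by_cases hij : i = j <;>
        simp [Module.Basis.toMatrix_apply, hij, add_comm]
    change (-(b.toMatrix w)).charpoly.eval (x : ℂ) = 0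
    rw [Matrix.eval_charpoly, hmat, ← Module.Basis.det_apply]
    exact hx
  exact measure_eq_zero_iff_ae_notMem.1 (hfin.countable.measure_zero volume)

/-- Almost every choice of `l` linear combinations of vectors spanning a space of dimension at most
`l` spans the same space. -/
theorem ae_forall_mem_span_sum_smul {H : Type*} [NormedAddCommGroup H] [NormedSpace ℂ H]
    {l m : ℕ} (v : Fin m → H)
    (hv : Module.finrank ℂ (Submodule.span ℂ (Set.range v)) ≤ l) :
    ∀ᵐ A : Fin l → Fin m → ℂ, ∀ j,
      v j ∈ Submodule.span ℂ (Set.range fun i => ∑ j, A i j • v j) := by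
  set V := Submodule.span ℂ (Set.range v) with hV
  have : FiniteDimensional ℂ V := FiniteDimensional.span_of_finite ℂ (Set.finite_range v)
  let b := Module.finBasis ℂ V
  let v' : Fin m → V := fun j => ⟨v j, Submodule.subset_span ⟨j, rfl⟩⟩
  -- Only the first `dim V` rows of `A` are used: it is enough that they already give a basis of
  -- `V`.
  let w : (Fin l → Fin m → ℂ) → Fin (Module.finrank ℂ V) → V :=
    fun A i => ∑ j, A (Fin.castLE hv i) j • v' j
  have hb : ∀ i, ∃ c : Fin m → ℂ, ∑ j, c j • v j = b i := fun i =>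
    (Submodule.mem_span_range_iff_exists_fun ℂ).1 (b i).2
  choose c hc using hb
  -- Direction along which `w` moves by multiples of `b`; the rows beyond `dim V` play no role and
  -- are set to zero.
  let A₁ : Fin l → Fin m → ℂ := fun i j =>
    if h : (i : ℕ) < Module.finrank ℂ V then c ⟨i, h⟩ j else 0
  have hwA₁ : w A₁ = b := by
    ext i
    simp [w, A₁, v', hc]
  have hw : ∀ A (x : ℝ), w (A + x • A₁) = w A + (x : ℂ) • ⇑b := fun A x => by
    rw [← hwA₁]
    ext i
    simp [w, add_smul, Finset.sum_add_distrib, Finset.smul_sum, mul_smul]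
  have hcont : Continuous fun A => b.det (w A) := by
    simp only [Module.Basis.det_apply]
    refine Continuous.matrix_det (continuous_matrix fun i j => ?_)
    simp only [Module.Basis.toMatrix_apply, w, map_sum, map_smul, Finsupp.coe_finsetSum,
      Finset.sum_apply, Finsupp.smul_apply]
    fun_prop
  have : (volume : Measure (Fin l → Fin m → ℂ)).IsAddHaarMeasure :=
    Measure.pi.isAddHaarMeasure _
  have hae : ∀ᵐ A : Fin l → Fin m → ℂ, A ∈ {A | b.det (w A) ≠ 0} := by
    -- A measurable set whose complement is null on every line parallel to `A₁` is conull.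
    refine ae_mem_of_ae_add_linearMap_mem
      (LinearMap.toSpanSingleton ℝ (Fin l → Fin m → ℂ) A₁) (volume : Measure ℝ) volume
      (isOpen_ne.preimage hcont).measurableSet fun A => ?_
    simpa [hw] using b.ae_det_add_smul_self_ne_zero (w A)
  filter_upwards [hae] with A hA j
  have hspan := ((Module.Basis.is_basis_iff_det b).2 (isUnit_iff_ne_zero.2 hA)).2
  have hmem : v' j ∈ Submodule.span ℂ (Set.range (w A)) := hspan ▸ Submodule.mem_top
  have hmem' := Submodule.mem_map_of_mem (f := V.subtype) hmem
  rw [Submodule.map_span, ← Set.range_comp] at hmem'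
  refine Submodule.span_mono ?_ hmem'
  rintro _ ⟨i, rfl⟩
  exact ⟨Fin.castLE hv i, by simp [w, v']⟩

end GenericCombinations

section Measurability

/-- A finite-dimensional span is closed, so membership amounts to approximation by combinations with
coefficients from a countable dense set. This countable form gives measurability. -/
theorem mem_span_range_iff_forall_exists_denseSeq {H : Type*} [NormedAddCommGroup H]
    [NormedSpace ℂ H] {l : ℕ} (w : Fin l → H) (y : H) :
    y ∈ Submodule.span ℂ (Set.range w) ↔
      ∀ n : ℕ, ∃ k : ℕ,
        ‖y - ∑ i, TopologicalSpace.denseSeq (Fin l → ℂ) k i • w i‖ < 1 / ((n : ℝ) + 1) := by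
  constructor
  · intro hy n
    obtain ⟨c, rfl⟩ := (Submodule.mem_span_range_iff_exists_fun ℂ).1 hy
    have hcont : Continuous fun d : Fin l → ℂ => ‖∑ i, c i • w i - ∑ i, d i • w i‖ := by
      fun_prop
    exact (TopologicalSpace.denseRange_denseSeq (Fin l → ℂ)).exists_mem_open
      (isOpen_Iio.preimage hcont) ⟨c, by simpa using Nat.cast_add_one_pos (α := ℝ) n⟩
  · intro h
    have : FiniteDimensional ℂ (Submodule.span ℂ (Set.range w)) :=
      FiniteDimensional.span_of_finite ℂ (Set.finite_range w)
    have hclosed : IsClosed (Submodule.span ℂ (Set.range w) : Set H) :=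
      Submodule.closed_of_finiteDimensional _
    refine hclosed.closure_subset (Metric.mem_closure_iff.2 fun ε hε => ?_)
    obtain ⟨n, hn⟩ := exists_nat_one_div_lt hε
    obtain ⟨k, hk⟩ := h n
    exact ⟨_, (Submodule.mem_span_range_iff_exists_fun ℂ).2 ⟨_, rfl⟩,
      by rw [dist_eq_norm]; exact hk.trans hn⟩

theorem MeasureTheory.StronglyMeasurable.measurableSet_mem_span_range {X H : Type*}
    [MeasurableSpace X] [NormedAddCommGroup H] [NormedSpace ℂ H] {l : ℕ}
    {w : Fin l → X → H} {y : X → H} (hw : ∀ i, StronglyMeasurable (w i))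
    (hy : StronglyMeasurable y) :
    MeasurableSet {x | y x ∈ Submodule.span ℂ (Set.range fun i => w i x)} := by
  simp only [mem_span_range_iff_forall_exists_denseSeq, Set.ofPred_forall, Set.ofPred_exists]
  refine MeasurableSet.iInter fun n => MeasurableSet.iUnion fun k => ?_
  refine StronglyMeasurable.measurableSet_lt ?_ stronglyMeasurable_const
  exact (hy.sub (Finset.stronglyMeasurable_fun_sum _ fun i _ => (hw i).const_smul _)).norm

end Measurability

section MISpan

variable {Ω : Type*} [MeasurableSpace Ω] {μ : Measure Ω}
  {H : Type*} [NormedAddCommGroup H] [InnerProductSpace ℂ H]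

/-- An `L²` limit is an a.e. limit along a subsequence, and the fibre spans, being
finite-dimensional, are closed. No property of `D` is needed. -/
theorem ae_mem_span_of_mem_miSpan (D : Set (Lp ℂ ∞ μ)) {ι : Type*} [Finite ι]
    (Ψ : ι → Lp H 2 μ) {G : Lp H 2 μ} (hG : G ∈ miSpan D (Set.range Ψ)) :
    ∀ᵐ ω ∂μ, G ω ∈ Submodule.span ℂ (Set.range fun i => Ψ i ω) := by
  have hspan : ∀ F ∈ Submodule.span ℂ
      {F : Lp H 2 μ | ∃ g ∈ D, ∃ Φ ∈ Set.range Ψ, F = g • Φ},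
      ∀ᵐ ω ∂μ, F ω ∈ Submodule.span ℂ (Set.range fun i => Ψ i ω) := by
    intro F hF
    induction hF using Submodule.span_induction with
    | mem F hF =>
      obtain ⟨g, -, _, ⟨i, rfl⟩, rfl⟩ := hF
      filter_upwards [Lp.coeFn_lpSMul (r := 2) g (Ψ i)] with ω hω
      rw [hω]
      exact Submodule.smul_mem _ _ (Submodule.subset_span ⟨i, rfl⟩)
    | zero =>
      filter_upwards [Lp.coeFn_zero H 2 μ] with ω hω
      rw [hω]
      exact zero_mem _
    | add F F' _ _ h h' =>
      filter_upwards [h, h', Lp.coeFn_add F F'] with ω h h' hω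
      rw [hω]
      exact add_mem h h'
    | smul c F _ h =>
      filter_upwards [h, Lp.coeFn_smul c F] with ω h hω
      rw [hω]
      exact Submodule.smul_mem _ _ h
  obtain ⟨u, hu, hlim⟩ := mem_closure_iff_seq_limit.1 hG
  obtain ⟨ns, -, hns⟩ := (tendstoInMeasure_of_tendsto_Lp hlim).exists_seq_tendsto_ae
  filter_upwards [hns, ae_all_iff.2 fun n => hspan (u n) (hu n)] with ω hω hmem
  have : FiniteDimensional ℂ (Submodule.span ℂ (Set.range fun i => Ψ i ω)) :=
    FiniteDimensional.span_of_finite ℂ (Set.finite_range _)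
  exact (Submodule.closed_of_finiteDimensional _).mem_of_tendsto hω
    (Filter.Eventually.of_forall fun n => hmem (ns n))

/-- The pointwise inner product is an `L¹` function whose integral against each `g ∈ D` is `⟪F, g •
Φ⟫ = 0`. -/
theorem IsDeterminingSet.ae_inner_eq_zero {D : Set (Lp ℂ ∞ μ)} (hD : IsDeterminingSet D)
    {F Φ : Lp H 2 μ} (h : ∀ g ∈ D, inner ℂ F (g • Φ : Lp H 2 μ) = 0) :
    ∀ᵐ ω ∂μ, inner ℂ (F ω) (Φ ω) = 0 := by
  have hint := L2.integrable_inner (𝕜 := ℂ) F Φ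
  have hzero : hint.toL1 = 0 := hD _ fun g hg => by
    rw [← h g hg, L2.inner_def]
    refine integral_congr_ae ?_
    filter_upwards [hint.coeFn_toL1, Lp.coeFn_lpSMul (r := 2) g Φ] with ω h₁ h₂
    rw [h₁, h₂, Pi.smul_apply', inner_smul_right, mul_comm]
  exact hint.coeFn_toL1.symm.trans (hzero ▸ Lp.coeFn_zero ℂ 1 μ)

variable [CompleteSpace H]

/-- By the double orthogonal complement, it suffices that every `F` orthogonal to the generators is
orthogonal to `G`; such an `F` is orthogonal to the `Ψ i` in almost every fibre, hence to `G` there.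
-/
theorem IsDeterminingSet.mem_miSpan {D : Set (Lp ℂ ∞ μ)} (hD : IsDeterminingSet D)
    {ι : Type*} [Finite ι] {Ψ : ι → Lp H 2 μ} {G : Lp H 2 μ}
    (hG : ∀ᵐ ω ∂μ, G ω ∈ Submodule.span ℂ (Set.range fun i => Ψ i ω)) :
    G ∈ miSpan D (Set.range Ψ) := by
  rw [miSpan, ← Submodule.orthogonal_orthogonal_eq_closure, Submodule.mem_orthogonal]
  intro F hF
  have hF' : ∀ᵐ ω ∂μ, ∀ i, inner ℂ (F ω) (Ψ i ω) = 0 := by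
    refine ae_all_iff.2 fun i => hD.ae_inner_eq_zero fun g hg => ?_
    refine Submodule.inner_left_of_mem_orthogonal (Submodule.subset_span ?_) hF
    exact ⟨g, hg, Ψ i, ⟨i, rfl⟩, rfl⟩
  rw [L2.inner_def]
  refine integral_eq_zero_of_ae ?_
  filter_upwards [hG, hF'] with ω hω hFω
  change inner ℂ (F ω) (G ω) = 0
  generalize G ω = y at hω
  induction hω using Submodule.span_induction with
  | mem _ h => obtain ⟨i, rfl⟩ := h; exact hFω i
  | zero => simp
  | add x y _ _ hx hy => simp_all
  | smul c x _ hx => simp_all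

/-- Under a determining set, membership in the generated space is a fibrewise condition. -/
theorem IsDeterminingSet.mem_miSpan_iff {D : Set (Lp ℂ ∞ μ)} (hD : IsDeterminingSet D)
    {ι : Type*} [Finite ι] {Ψ : ι → Lp H 2 μ} {G : Lp H 2 μ} :
    G ∈ miSpan D (Set.range Ψ) ↔
      ∀ᵐ ω ∂μ, G ω ∈ Submodule.span ℂ (Set.range fun i => Ψ i ω) :=
  ⟨ae_mem_span_of_mem_miSpan D Ψ, hD.mem_miSpan⟩

theorem IsDeterminingSet.miSpan_le_miSpan {D : Set (Lp ℂ ∞ μ)} (hD : IsDeterminingSet D)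
    {ι κ : Type*} [Finite ι] [Finite κ] {Φ : ι → Lp H 2 μ} {Ψ : κ → Lp H 2 μ}
    (h : ∀ᵐ ω ∂μ, ∀ j, Φ j ω ∈ Submodule.span ℂ (Set.range fun i => Ψ i ω)) :
    miSpan D (Set.range Φ) ≤ miSpan D (Set.range Ψ) := by
  intro G hG
  rw [hD.mem_miSpan_iff] at hG ⊢
  filter_upwards [hG, h] with ω hGω hω
  exact Submodule.span_le.2 (Set.range_subset_iff.2 hω) hGω

theorem IsDeterminingSet.ae_finrank_span_le_miLength {D : Set (Lp ℂ ∞ μ)}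
    (hD : IsDeterminingSet D) {m : ℕ} (Φ : Fin m → Lp H 2 μ) :
    ∀ᵐ ω ∂μ, Module.finrank ℂ (Submodule.span ℂ (Set.range fun j => Φ j ω)) ≤
      miLength D (miSpan D (Set.range Φ)) := by
  have hmem : ∀ j, Φ j ∈ miSpan D (Set.range Φ) := fun j =>
    hD.mem_miSpan (.of_forall fun ω => Submodule.subset_span ⟨j, rfl⟩)
  -- `Φ` itself shows that the set of admissible lengths is non-empty, so the infimum is attained.
  obtain ⟨Θ, -, hΘ⟩ := Nat.sInf_mem (s := {n : ℕ | ∃ Θ : Fin n → Lp H 2 μ,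
    (∀ i, Θ i ∈ miSpan D (Set.range Φ)) ∧ miSpan D (Set.range Φ) = miSpan D (Set.range Θ)})
    ⟨m, Φ, hmem, rfl⟩
  filter_upwards [ae_all_iff.2 fun j => ae_mem_span_of_mem_miSpan D Θ (hΘ ▸ hmem j)] with ω hω
  have : FiniteDimensional ℂ (Submodule.span ℂ (Set.range fun i => Θ i ω)) :=
    FiniteDimensional.span_of_finite ℂ (Set.finite_range _)
  refine (Submodule.finrank_mono (Submodule.span_le.2 (Set.range_subset_iff.2 hω))).trans ?_
  exact (finrank_range_le_card _).trans_eq (Fintype.card_fin _)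

end MISpan

theorem theorem3p3 {Ω : Type*} [MeasurableSpace Ω] (μ : Measure Ω) [SigmaFinite μ]
    {H : Type*} [NormedAddCommGroup H] [InnerProductSpace ℂ H] [CompleteSpace H]
    [TopologicalSpace.SeparableSpace H]
    (D : Set (Lp ℂ ∞ μ)) (hD : IsDeterminingSet D)
    (m : ℕ) (Φ : Fin m → Lp H 2 μ)
    (M : Submodule ℂ (Lp H 2 μ)) (hM : M = miSpan D (Set.range Φ))
    (l : ℕ) (hMl : miLength D M ≤ l) (hlm : l ≤ m) :
    (volume : Measure (Fin l → Fin m → ℂ))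
      {A : Fin l → Fin m → ℂ |
        M = miSpan D (Set.range fun i : Fin l => ∑ j : Fin m, A i j • Φ j)}ᶜ = 0 := by
  subst hM
  have hmeas : MeasurableSet {x : (Fin l → Fin m → ℂ) × Ω | ∀ j, Φ j x.2 ∈
      Submodule.span ℂ (Set.range fun i => ∑ j, x.1 i j • Φ j x.2)} := by
    have hΦ : ∀ j, StronglyMeasurable fun x : (Fin l → Fin m → ℂ) × Ω => Φ j x.2 := fun j =>
      (Lp.stronglyMeasurable (Φ j)).comp_measurable measurable_snd
    rw [Set.ofPred_forall]
    refine MeasurableSet.iInter fun j => ?_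
    refine StronglyMeasurable.measurableSet_mem_span_range (fun i => ?_) (hΦ j)
    refine Finset.stronglyMeasurable_fun_sum _ fun k _ => StronglyMeasurable.smul ?_ (hΦ k)
    exact Measurable.stronglyMeasurable (by fun_prop)
  have hae : ∀ᵐ A : Fin l → Fin m → ℂ, ∀ᵐ ω ∂μ, ∀ j, Φ j ω ∈
      Submodule.span ℂ (Set.range fun i => ∑ j, A i j • Φ j ω) := by
    -- Fubini: joint measurability in `(A, ω)` allows `ω` to be fixed first.
    refine (Measure.ae_ae_comm hmeas).2 ?_
    filter_upwards [hD.ae_finrank_span_le_miLength Φ] with ω hω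
    exact ae_forall_mem_span_sum_smul _ (hω.trans hMl)
  refine mem_ae_iff.1 (hae.mono fun A hA => ?_)
  have hcoe : ∀ᵐ ω ∂μ, ∀ i, (∑ j, A i j • Φ j : Lp H 2 μ) ω = ∑ j, A i j • Φ j ω := by
    refine ae_all_iff.2 fun i => ?_
    filter_upwards [Lp.coeFn_finsetSum Finset.univ fun j => A i j • Φ j,
      ae_all_iff.2 fun j => Lp.coeFn_smul (A i j) (Φ j)] with ω h₁ h₂
    rw [h₁, Finset.sum_apply]
    exact Finset.sum_congr rfl fun j _ => h₂ j
  refine le_antisymm (hD.miSpan_le_miSpan ?_) (hD.miSpan_le_miSpan ?_)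
  · filter_upwards [hA, hcoe] with ω hω hc
    simpa only [hc] using hω
  · filter_upwards [hcoe] with ω hc i
    rw [hc]
    exact Submodule.sum_mem _ fun j _ => Submodule.smul_mem _ _ (Submodule.subset_span ⟨j, rfl⟩)
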